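/- Let $d\ge 2$ be an integer, $r\in(0,1]$ and $q\ge 1$ a real number. Let $\mathcal K^{(1)}_{r,d}$ be the class of all convex bodies $K\subset\mathbb R^d$ (compact convex sets of positive volume) that are contained in the closed Euclidean unit ball centred at the origin and satisfy the $r$-rolling condition: for every $x\in\partial K$ there is a closed Euclidean ball $B$ of radius $r$ with $x\in B\subseteq K$. For $K\in\mathcal K^{(1)}_{r,d}$, the surface area $\mathcal H^{d-1}(\partial K)$ is positive and finite, so that the uniform distribution on $\partial K$, $\sigma_K=\mathcal H^{d-1}(\,\cdot\cap\partial K)/\mathcal H^{d-1}(\partial K)$, is a probability measure ($\mathcal H^{d-1}$ is the $(d-1)$-dimensional Hausdorff measure). Let $X_1,\dots,X_n$ be independent random points with law $\sigma_K$, let $\widehat K_n=\mathrm{conv}\{X_1,\dots,X_n\}$, let $\mathbb E_{\partial K}$ denote the corresponding expectation, and let $d_H$ be the Hausdorff distance for the Euclidean metric. Then there is a constant $C>0$, depending only on $d$, $r$ and $q$, such that for all integers $n\ge 2$ $$\sup_{K\in\mathcal K^{(1)}_{r,d}}\mathbb E_{\partial K}\bigl[d_H(\widehat K_n,K)^q\bigr]\le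 C\left(\frac{\ln n}{n}\right)^{\frac{2q}{d-1}}.$$ -/

import Mathlib

open MeasureTheory ProbabilityTheory
open scoped ENNReal

noncomputable section

/-- The `r`-rolling condition: through every boundary point of `K` there passes a closed
Euclidean ball of radius `r` that is contained in `K`. -/
def RollingCondition {d : ℕ} (r : ℝ) (K : Set (EuclideanSpace ℝ (Fin d))) : Prop :=
  ∀ x ∈ frontier K, ∃ c : EuclideanSpace ℝ (Fin d),
    x ∈ Metric.closedBall c r ∧ Metric.closedBall c r ⊆ K

/-- The class of convex bodies (compact, convex, of positive volume) in `ℝ^d` that are contained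
in the closed unit ball centred at the origin and satisfy the `r`-rolling condition. -/
def rollingBodies (r : ℝ) (d : ℕ) : Set (ConvexBody (EuclideanSpace ℝ (Fin d))) :=
  {K | 0 < volume (K : Set (EuclideanSpace ℝ (Fin d))) ∧
    (K : Set (EuclideanSpace ℝ (Fin d))) ⊆ Metric.closedBall 0 1 ∧
    RollingCondition r (K : Set (EuclideanSpace ℝ (Fin d)))}

/-- The uniform probability measure on the boundary of `K`: the surface area measure, i.e. the
`(d-1)`-dimensional Hausdorff measure, restricted to the boundary of `K` and divided by the
surface area of the boundary. (The normalising constant of the Hausdorff measure cancels.) -/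
def uniformBoundary {d : ℕ} (K : Set (EuclideanSpace ℝ (Fin d))) :
    Measure (EuclideanSpace ℝ (Fin d)) :=
  ProbabilityTheory.cond (Measure.hausdorffMeasure ((d : ℝ) - 1)) (frontier K)

/-- The random polytope: the convex hull of the points `X 0, …, X (n-1)`. -/
def randomPolytope {d n : ℕ} (X : Fin n → EuclideanSpace ℝ (Fin d)) :
    Set (EuclideanSpace ℝ (Fin d)) :=
  convexHull ℝ (Set.range X)

/-- The `q`-th moment of the Hausdorff distance between the random polytope and `K`, where the
`n` points are independent and uniformly distributed on the boundary of `K`. -/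
def boundaryMoment {d : ℕ} (K : Set (EuclideanSpace ℝ (Fin d))) (n : ℕ) (q : ℝ) : ℝ≥0∞ :=
  ∫⁻ X : Fin n → EuclideanSpace ℝ (Fin d),
    ENNReal.ofReal (Metric.hausdorffDist (randomPolytope X) K ^ q)
    ∂(Measure.pi fun _ : Fin n => uniformBoundary K)

end

/-!
The law of the random points enters only through the masses it gives to caps. If `K` contains a ball
of radius `r` through its extreme point in direction `u`, then the part of `∂K` in the cap of height
`t` in direction `u` projects along `u` onto a set containing a `(d - 1)`-dimensional ball of radius
about `√(r t)`, and projections do not increase Hausdorff measure. Moreover `∂K` has at most the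
surface area of the unit sphere, because pushing boundary points of `K` outwards along normals until
they hit the sphere does not decrease distances. Hence every cap of height `t` has mass at least
`c t^α` with `α = (d - 1) / 2`.

If the convex hull of the sample is at Hausdorff distance more than `2t` from `K`, then some cap of
height `t`, with direction in a fixed net of the unit sphere of mesh of order `t`, contains no
sample point. By the union bound over the net this has probability at most
`C t^(-d) exp (-n c t^α)`, and taking for `t^α` a large multiple of `log n / n` makes this at most
a multiple of `t^q`.
-/

section ConvexGeometry

open Metric Set

theorem exists_nonneg_add_smul_mem_frontier {E : Type*} [NormedAddCommGroup E] [NormedSpace ℝ E]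
    {K : Set E} (hK : Bornology.IsBounded K) {z u : E} (hz : z ∈ K) (hu : u ≠ 0) :
    ∃ s : ℝ, 0 ≤ s ∧ z + s • u ∈ frontier K := by
  let f : NNReal → E := fun s => z + (s : ℝ) • u
  have hf : Continuous f := by fun_prop
  have hne : (f ⁻¹' K).Nonempty := ⟨0, by simpa [f] using hz⟩
  have hne_univ : f ⁻¹' K ≠ univ := by
    intro huniv
    obtain ⟨R, hR, hKR⟩ := hK.exists_pos_norm_le
    have hbound : ‖z + ((R + ‖z‖ + 1) / ‖u‖) • u‖ ≤ R :=
      hKR _ (huniv.ge (mem_univ (⟨(R + ‖z‖ + 1) / ‖u‖, by positivity⟩ : NNReal)))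
    have hreverse := norm_sub_norm_le (((R + ‖z‖ + 1) / ‖u‖) • u) (-z)
    rw [norm_neg, sub_neg_eq_add, add_comm _ z, norm_smul, Real.norm_of_nonneg (by positivity),
      div_mul_cancel₀ _ (norm_ne_zero_iff.2 hu)] at hreverse
    linarith
  obtain ⟨s, hs⟩ := nonempty_frontier_iff.2 ⟨hne, hne_univ⟩
  exact ⟨s, s.2, hf.frontier_preimage_subset K hs⟩

variable {E : Type*} [NormedAddCommGroup E] [InnerProductSpace ℝ E] {K L : Set E} {u v x y : E}

theorem mem_frontier_of_isMaxOn_inner (hu : u ≠ 0) (hx : x ∈ K) (hmax : IsMaxOn (inner ℝ u) K x) :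
    x ∈ frontier K := by
  refine ⟨subset_closure hx, fun hint => hu ?_⟩
  have hderiv := (hmax.isLocalMax (mem_interior_iff_mem_nhds.1 hint)).hasFDerivAt_eq_zero
    (innerSL ℝ u).hasFDerivAt
  exact innerSL_inj.1 (hderiv.trans (map_zero _).symm)

theorem exists_unit_isMaxOn_inner_of_mem_frontier [CompleteSpace E] (hK : Convex ℝ K)
    (hint : (interior K).Nonempty) (hx : x ∈ frontier K) :
    ∃ u : E, ‖u‖ = 1 ∧ IsMaxOn (inner ℝ u) K x := by
  obtain ⟨f, hf⟩ := geometric_hahn_banach_open_point hK.interior isOpen_interior hx.2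
  have hmax : ∀ y ∈ K, f y ≤ f x := fun y hy =>
    closure_minimal (fun z hz => (hf z hz).le) (isClosed_le f.continuous continuous_const)
      (hK.closure_interior_eq_closure_of_nonempty_interior hint ▸ subset_closure hy)
  obtain ⟨v, rfl⟩ := (InnerProductSpace.toDual ℝ E).surjective f
  have hv : v ≠ 0 := by
    rintro rfl
    obtain ⟨z, hz⟩ := hint
    simpa using hf z hz
  refine ⟨‖v‖⁻¹ • v, norm_smul_inv_norm hv, fun y hy => ?_⟩
  simp only [mem_ofPred_eq, real_inner_smul_left]
  exact mul_le_mul_of_nonneg_left (hmax y hy) (by positivity)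

theorem norm_sub_le_norm_add_smul_sub_add_smul {s t : ℝ} (hs : 0 ≤ s) (ht : 0 ≤ t)
    (hu : inner ℝ u y ≤ inner ℝ u x) (hv : inner ℝ v x ≤ inner ℝ v y) :
    ‖x - y‖ ≤ ‖(x + s • u) - (y + t • v)‖ := by
  have hsq : ‖x - y‖ * ‖x - y‖ ≤ ‖(x + s • u) - (y + t • v)‖ * ‖x - y‖ :=
    calc ‖x - y‖ * ‖x - y‖
        ≤ ‖x - y‖ * ‖x - y‖ + s * (inner ℝ u x - inner ℝ u y)
            + t * (inner ℝ v y - inner ℝ v x) := by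
          linarith [mul_nonneg hs (sub_nonneg.2 hu), mul_nonneg ht (sub_nonneg.2 hv)]
      _ = inner ℝ ((x + s • u) - (y + t • v)) (x - y) := by
          rw [← real_inner_self_eq_norm_mul_norm]
          simp only [inner_add_left, inner_sub_left, inner_sub_right, real_inner_smul_left]
          ring
      _ ≤ ‖(x + s • u) - (y + t • v)‖ * ‖x - y‖ := real_inner_le_norm _ _
  rcases (norm_nonneg (x - y)).eq_or_lt with h0 | h0
  · exact h0 ▸ norm_nonneg _
  · exact le_of_mul_le_mul_right hsq h0

theorem hausdorffMeasure_frontier_mono [CompleteSpace E] [MeasurableSpace E] [BorelSpace E]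
    (hK : Convex ℝ K) (hcl : IsClosed K) (hint : (interior K).Nonempty) (hKL : K ⊆ L)
    (hL : Bornology.IsBounded L) {d : ℝ} (hd : 0 ≤ d) :
    μH[d] (frontier K) ≤ μH[d] (frontier L) := by
  have hpush : ∀ x : frontier K, ∃ u : E, IsMaxOn (inner ℝ u) K x ∧
      ∃ s : ℝ, 0 ≤ s ∧ (x : E) + s • u ∈ frontier L := fun x => by
    obtain ⟨u, hu, hmax⟩ := exists_unit_isMaxOn_inner_of_mem_frontier hK hint x.2
    exact ⟨u, hmax, exists_nonneg_add_smul_mem_frontier hL (hKL (hcl.frontier_subset x.2))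
      (norm_ne_zero_iff.1 (hu ▸ one_ne_zero))⟩
  choose u hmax s hs hmem using hpush
  let f : frontier K → E := fun x => x + s x • u x
  have hf : AntilipschitzWith 1 f := AntilipschitzWith.of_le_mul_dist fun x y => by
    rw [NNReal.coe_one, one_mul, Subtype.dist_eq, dist_eq_norm, dist_eq_norm]
    exact norm_sub_le_norm_add_smul_sub_add_smul (hs x) (hs y)
      (hmax x (hcl.frontier_subset y.2)) (hmax y (hcl.frontier_subset x.2))
  calc μH[d] (frontier K) = μH[d] (univ : Set (frontier K)) := by
        simpa using isometry_subtype_coe.hausdorffMeasure_image (.inl hd)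
          (univ : Set (frontier K))
    _ ≤ μH[d] (f '' univ) := by simpa using hf.le_hausdorffMeasure_image hd univ
    _ ≤ μH[d] (frontier L) := measure_mono (by rintro _ ⟨x, -, rfl⟩; exact hmem x)

end ConvexGeometry

section SurfaceArea

open Metric Set

variable {m : ℕ}

theorem sphere_pi_subset_iUnion_insertNth_image (x : Fin (m + 1) → ℝ) (R : ℝ) :
    sphere x R ⊆ ⋃ i ∈ (univ : Set (Fin (m + 1))), ⋃ a ∈ ({x i - R, x i + R} : Set ℝ),
      i.insertNth (α := fun _ => ℝ) a '' closedBall (i.removeNth x) R := by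
  intro y hy
  have hR : 0 ≤ R := nonneg_of_mem_sphere hy
  have hle := (dist_pi_le_iff hR).1 (mem_sphere.1 hy).le
  obtain ⟨i, hi⟩ : ∃ i, dist (y i) (x i) = R := by
    by_contra! h
    rcases hR.eq_or_lt with rfl | hpos
    · exact h 0 ((hle 0).antisymm dist_nonneg)
    · exact ((dist_pi_lt_iff hpos).2 fun i => (hle i).lt_of_ne (h i)).ne hy
  have hyi : y i ∈ ({x i - R, x i + R} : Set ℝ) := by
    rcases eq_or_eq_neg_of_abs_eq hi with h | h
    · exact .inr (by rw [mem_singleton_iff]; linarith)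
    · exact .inl (by linarith)
  exact mem_biUnion (mem_univ i) (mem_biUnion hyi ⟨i.removeNth y,
    (dist_pi_le_iff hR).2 fun j => hle (i.succAbove j), i.insertNth_self_removeNth y⟩)

theorem hausdorffMeasure_sphere_pi_lt_top (x : Fin (m + 1) → ℝ) (R : ℝ) :
    μH[m] (sphere x R) < ∞ := by
  have hvol : (μH[m] : Measure (Fin m → ℝ)) = volume := by
    simpa using hausdorffMeasure_pi_real (ι := Fin m)
  refine (measure_mono (sphere_pi_subset_iUnion_insertNth_image x R)).trans_lt <|
    measure_biUnion_lt_top finite_univ fun i _ =>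
      measure_biUnion_lt_top (toFinite _) fun a _ => ?_
  have hiso : Isometry (i.insertNth (α := fun _ => ℝ) a) := Isometry.of_dist_eq fun y z => by
    rw [Fin.dist_insertNth_insertNth, dist_self, max_eq_right dist_nonneg]
  rw [hiso.hausdorffMeasure_image (.inl m.cast_nonneg), hvol]
  exact measure_closedBall_lt_top

theorem hausdorffMeasure_frontier_lt_top {K : Set (EuclideanSpace ℝ (Fin (m + 1)))}
    (hK : Convex ℝ K) (hcl : IsClosed K) (hint : (interior K).Nonempty)
    (hbdd : Bornology.IsBounded K) : μH[m] (frontier K) < ∞ := by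
  have htoLp := PiLp.lipschitzWith_toLp 2 fun _ : Fin (m + 1) => ℝ
  obtain ⟨R, hR⟩ := (isBounded_iff_subset_closedBall 0).1
    ((PiLp.lipschitzWith_ofLp 2 fun _ : Fin (m + 1) => ℝ).isBounded_image hbdd)
  have hcube : Bornology.IsBounded (WithLp.ofLp (p := 2) ⁻¹' closedBall (0 : Fin (m + 1) → ℝ) R) :=
    (htoLp.isBounded_image isBounded_closedBall).subset fun y hy => ⟨y.ofLp, hy, rfl⟩
  calc μH[m] (frontier K)
      ≤ μH[m] (frontier (WithLp.ofLp (p := 2) ⁻¹' closedBall (0 : Fin (m + 1) → ℝ) R)) :=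
        hausdorffMeasure_frontier_mono hK hcl hint (image_subset_iff.1 hR) hcube m.cast_nonneg
    _ ≤ μH[m] (WithLp.toLp 2 '' sphere (0 : Fin (m + 1) → ℝ) R) :=
        measure_mono fun y hy => ⟨y.ofLp, frontier_closedBall_subset_sphere
          ((PiLp.continuous_ofLp 2 _).frontier_preimage_subset _ hy), rfl⟩
    _ < ∞ := (htoLp.hausdorffMeasure_image_le m.cast_nonneg _).trans_lt <|
        ENNReal.mul_lt_top (ENNReal.rpow_lt_top_of_nonneg m.cast_nonneg ENNReal.coe_ne_top)
          (hausdorffMeasure_sphere_pi_lt_top 0 R)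

end SurfaceArea

section Caps

open Metric Module Set

/-- The open half-space cutting off from `K` its cap of height `t` in direction `u`. The supremum
of `inner ℝ u` over `K` is avoided by quantifying over the points of `K`, so that for `K = ∅` this
is the whole space. -/
def capHalfSpace {E : Type*} [NormedAddCommGroup E] [InnerProductSpace ℝ E] (K : Set E) (u : E)
    (t : ℝ) : Set E :=
  {y | ∀ x ∈ K, inner ℝ u x - t < inner ℝ u y}

variable {E : Type*} [NormedAddCommGroup E] [InnerProductSpace ℝ E] {K : Set E} {c p u v x : E}
  {r t δ ρ : ℝ}

theorem capHalfSpace_eq_of_isMaxOn (hx : x ∈ K) (hmax : IsMaxOn (inner ℝ u) K x) :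
    capHalfSpace K u t = {y | inner ℝ u x - t < inner ℝ u y} :=
  Subset.antisymm (fun _ hy => hy x hx)
    fun _ hy _ hz => (sub_le_sub_right (hmax hz) t).trans_lt hy

theorem isOpen_capHalfSpace (hK : IsCompact K) : IsOpen (capHalfSpace K u t) := by
  rcases K.eq_empty_or_nonempty with rfl | hne
  · simp [capHalfSpace]
  · obtain ⟨x, hx, hmax⟩ := hK.exists_isMaxOn hne (f := inner ℝ u) (by fun_prop)
    rw [capHalfSpace_eq_of_isMaxOn hx hmax]
    exact isOpen_lt continuous_const (by fun_prop)

theorem inter_capHalfSpace_subset_capHalfSpace (hK : K ⊆ closedBall 0 1) (huv : ‖u - v‖ ≤ δ) :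
    K ∩ capHalfSpace K v (t - 2 * δ) ⊆ capHalfSpace K u t := by
  have habs : ∀ z ∈ K, |inner ℝ u z - inner ℝ v z| ≤ δ := fun z hz => by
    rw [← inner_sub_left]
    exact (abs_real_inner_le_norm _ _).trans <| (mul_le_of_le_one_right (norm_nonneg _)
      (mem_closedBall_zero_iff.1 (hK hz))).trans huv
  rintro y ⟨hyK, hy⟩ x hx
  linarith [hy x hx, (abs_le.1 (habs y hyK)).1, (abs_le.1 (habs x hx)).2]

theorem add_add_smul_mem_closedBall (hr : 0 < r) (hu : ‖u‖ = 1) (hup : inner ℝ u p = 0)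
    (hp : ‖p‖ ≤ r) : c + p + (r - ‖p‖ ^ 2 / r) • u ∈ closedBall c r := by
  have hle : ‖p‖ ^ 2 / r ≤ r := (div_le_iff₀ hr).2 (by nlinarith [norm_nonneg p])
  rw [mem_closedBall, dist_eq_norm, add_assoc, add_sub_cancel_left]
  refine (sq_le_sq₀ (norm_nonneg _) hr.le).1 ?_
  calc ‖p + (r - ‖p‖ ^ 2 / r) • u‖ ^ 2 = ‖p‖ ^ 2 / r * r + (r - ‖p‖ ^ 2 / r) ^ 2 := by
        rw [norm_add_sq_real, real_inner_smul_right, real_inner_comm, hup, norm_smul, hu,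
          Real.norm_eq_abs, mul_one, sq_abs, div_mul_cancel₀ _ hr.ne']
        ring
    _ ≤ r ^ 2 := by nlinarith [div_nonneg (sq_nonneg ‖p‖) hr.le]

theorem exists_add_smul_mem_frontier_inter_capHalfSpace (hK : Bornology.IsBounded K) (hr : 0 < r)
    (hball : closedBall c r ⊆ K) (hxK : x ∈ K) (hxc : x ∈ closedBall c r) (hu : ‖u‖ = 1)
    (hmax : IsMaxOn (inner ℝ u) K x) (hup : inner ℝ u p = 0) (hp : ‖p‖ ≤ r)
    (hpt : ‖p‖ ^ 2 < r * t) : ∃ s : ℝ, c + p + s • u ∈ frontier K ∩ capHalfSpace K u t := by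
  obtain ⟨s, hs, hfrontier⟩ := exists_nonneg_add_smul_mem_frontier hK
    (hball (add_add_smul_mem_closedBall hr hu hup hp)) (norm_ne_zero_iff.1 (hu ▸ one_ne_zero))
  rw [add_assoc _ _ (s • u), ← add_smul] at hfrontier
  refine ⟨_, hfrontier, ?_⟩
  rw [capHalfSpace_eq_of_isMaxOn hxK hmax, mem_ofPred_eq]
  have hxc' : inner ℝ u (x - c) ≤ r := (real_inner_le_norm _ _).trans <| by
    rw [hu, one_mul, ← dist_eq_norm]; exact hxc
  have hlt : ‖p‖ ^ 2 / r < t := (div_lt_iff₀' hr).2 hpt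
  rw [inner_sub_right] at hxc'
  rw [inner_add_right, inner_add_right, real_inner_smul_right, hup, real_inner_self_eq_norm_sq, hu]
  linarith

variable [MeasurableSpace E] [BorelSpace E]

theorem hausdorffMeasure_closedBall_of_finrank {m : ℕ} [FiniteDimensional ℝ E]
    (hm : finrank ℝ E = m) (x : E) (hρ : 0 ≤ ρ) :
    μH[m] (closedBall x ρ) =
      ENNReal.ofReal (ρ ^ m) * μH[m] (ball (0 : EuclideanSpace ℝ (Fin m)) 1) := by
  subst hm
  let e := (stdOrthonormalBasis ℝ E).repr
  rw [← e.isometry.hausdorffMeasure_image (.inl (Nat.cast_nonneg _)), e.image_closedBall,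
    Measure.addHaar_closedBall _ _ hρ, finrank_euclideanSpace_fin]

theorem le_hausdorffMeasure_frontier_inter_capHalfSpace {m : ℕ} [Fact (finrank ℝ E = m + 1)]
    (hK : Bornology.IsBounded K) (hr : 0 < r) (hball : closedBall c r ⊆ K) (hxK : x ∈ K)
    (hxc : x ∈ closedBall c r) (hu : ‖u‖ = 1) (hmax : IsMaxOn (inner ℝ u) K x) (hρ : 0 ≤ ρ)
    (hρr : ρ ≤ r) (hρt : ρ ^ 2 < r * t) :
    ENNReal.ofReal (ρ ^ m) * μH[m] (ball (0 : EuclideanSpace ℝ (Fin m)) 1) ≤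
      μH[m] (frontier K ∩ capHalfSpace K u t) := by
  have := FiniteDimensional.of_fact_finrank_eq_succ (K := ℝ) (V := E) m
  have hfin : finrank ℝ (ℝ ∙ u)ᗮ = m :=
    Submodule.finrank_orthogonal_span_singleton (norm_ne_zero_iff.1 (hu ▸ one_ne_zero))
  let P := (ℝ ∙ u)ᗮ.orthogonalProjectionOnto
  have hPu : P u = 0 :=
    Submodule.orthogonalProjectionOnto_orthogonal_apply_eq_zero
      (Submodule.mem_span_singleton_self u)
  have hproj : closedBall (P c) ρ ⊆ P '' (frontier K ∩ capHalfSpace K u t) := by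
    intro w hw
    rw [mem_closedBall, dist_eq_norm] at hw
    obtain ⟨s, hs⟩ := exists_add_smul_mem_frontier_inter_capHalfSpace hK hr hball hxK hxc hu hmax
      (Submodule.mem_orthogonal_singleton_iff_inner_right.1 (w - P c).2) (hw.trans hρr)
      ((pow_le_pow_left₀ (norm_nonneg _) hw 2).trans_lt hρt)
    refine ⟨_, hs, ?_⟩
    rw [map_add, map_add, map_smul, hPu, smul_zero, add_zero,
      Submodule.orthogonalProjectionOnto_mem_subspace_eq_self, add_sub_cancel]
  calc _ = μH[m] (closedBall (P c) ρ) := (hausdorffMeasure_closedBall_of_finrank hfin _ hρ).symm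
    _ ≤ μH[m] (P '' (frontier K ∩ capHalfSpace K u t)) := measure_mono hproj
    _ ≤ μH[m] (frontier K ∩ capHalfSpace K u t) :=
      hausdorffMeasure_orthogonalProjectionOnto_le _ _ _ m.cast_nonneg

end Caps

section HausdorffDistance

open Metric Set

variable {E : Type*} [NormedAddCommGroup E] [InnerProductSpace ℝ E] {S A K : Set E} {x : E} {t : ℝ}

theorem exists_unit_forall_inner_le_inner_sub_infDist (hS : Convex ℝ S) (hcomplete : IsComplete S)
    (hne : S.Nonempty) (hx : 0 < infDist x S) :
    ∃ u : E, ‖u‖ = 1 ∧ ∀ a ∈ S, inner ℝ u a ≤ inner ℝ u x - infDist x S := by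
  obtain ⟨y, hy, hxy⟩ := exists_norm_eq_iInf_of_complete_convex hne hcomplete hS x
  have hdist : infDist x S = ‖x - y‖ := by simp only [infDist_eq_iInf, dist_eq_norm, hxy]
  have hobtuse := (norm_eq_iInf_iff_real_inner_le_zero hS hy).1 hxy
  rw [hdist] at hx ⊢
  refine ⟨‖x - y‖⁻¹ • (x - y), norm_smul_inv_norm (norm_pos_iff.1 hx), fun a ha => ?_⟩
  have hsplit : inner ℝ (x - y) x - ‖x - y‖ * ‖x - y‖ = inner ℝ (x - y) y := by
    rw [← real_inner_self_eq_norm_mul_norm, ← inner_sub_right, sub_sub_cancel]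
  have hle : inner ℝ (x - y) a ≤ inner ℝ (x - y) y := by
    simpa [inner_sub_right] using hobtuse a ha
  rw [real_inner_smul_left, real_inner_smul_left, inv_mul_le_iff₀ hx, mul_sub,
    mul_inv_cancel_left₀ hx.ne', hsplit]
  exact hle

theorem exists_mem_lt_infDist_of_lt_hausdorffDist {α : Type*} [PseudoMetricSpace α] {S K : Set α}
    {t : ℝ} (hSK : S ⊆ K) (ht : 0 ≤ t) (hlt : t < hausdorffDist S K) :
    ∃ x ∈ K, t < infDist x S := by
  by_contra! h
  exact hlt.not_ge <| hausdorffDist_le_of_infDist ht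
    (fun x hx => (infDist_zero_of_mem (hSK hx)).trans_le ht) h

theorem exists_disjoint_capHalfSpace_of_lt_hausdorffDist [CompleteSpace E] (hK : Convex ℝ K)
    (hAK : A ⊆ K) (hA : A.Nonempty) (ht : 0 ≤ t) (hlt : t < hausdorffDist (convexHull ℝ A) K) :
    ∃ u : E, ‖u‖ = 1 ∧ Disjoint A (capHalfSpace K u t) := by
  obtain ⟨x, hxK, hx⟩ := exists_mem_lt_infDist_of_lt_hausdorffDist (convexHull_min hAK hK) ht hlt
  rw [← infDist_closure] at hx
  obtain ⟨u, hu, hux⟩ := exists_unit_forall_inner_le_inner_sub_infDist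
    (convex_convexHull ℝ A).closure isClosed_closure.isComplete
    (hA.convexHull.closure) (ht.trans_lt hx)
  refine ⟨u, hu, disjoint_left.2 fun a ha hcap => ?_⟩
  linarith [hcap x hxK, hux a (subset_closure (subset_convexHull ℝ A ha))]

theorem exists_forall_notMem_capHalfSpace_of_lt_hausdorffDist [CompleteSpace E] {ι : Type*}
    [Nonempty ι] {X : ι → E} (hK : Convex ℝ K) (hball : K ⊆ closedBall 0 1) (ht : 0 ≤ t) {S : Set E}
    (hS : IsCover (t / 2).toNNReal (sphere 0 1) S)
    (hX : ∀ i, X i ∈ K) (hlt : 2 * t < hausdorffDist (convexHull ℝ (range X)) K) :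
    ∃ v ∈ S, ∀ i, X i ∉ capHalfSpace K v t := by
  obtain ⟨u, hu, hdisj⟩ := exists_disjoint_capHalfSpace_of_lt_hausdorffDist hK
    (range_subset_iff.2 hX) (range_nonempty X) (by positivity) hlt
  obtain ⟨v, hvS, huv⟩ := hS (mem_sphere_zero_iff_norm.2 hu)
  refine ⟨v, hvS, fun i hi => disjoint_left.1 hdisj ⟨i, rfl⟩ ?_⟩
  have hdist : ‖u - v‖ ≤ t / 2 := by
    rw [← dist_eq_norm, ← edist_le_ofReal (by positivity)]
    exact huv
  exact inter_capHalfSpace_subset_capHalfSpace hball hdist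
    ⟨hX i, by rwa [mul_div_cancel₀ _ two_ne_zero, two_mul, add_sub_cancel_right]⟩

theorem hausdorffDist_convexHull_le_two_mul {E : Type*} [NormedAddCommGroup E] [NormedSpace ℝ E]
    {A K : Set E} {x : E} {R : ℝ} (hR : 0 ≤ R) (hA : A.Nonempty) (hAball : A ⊆ closedBall x R)
    (hK : K.Nonempty) (hKball : K ⊆ closedBall x R) :
    hausdorffDist (convexHull ℝ A) K ≤ 2 * R := by
  have hhull : convexHull ℝ A ⊆ closedBall x R := convexHull_min hAball (convex_closedBall x R)
  calc hausdorffDist (convexHull ℝ A) K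
      ≤ diam (convexHull ℝ A ∪ K) := hausdorffDist_le_diam hA.convexHull
        (isBounded_closedBall.subset hhull) hK (isBounded_closedBall.subset hKball)
    _ ≤ diam (closedBall x R) := diam_mono (union_subset hhull hKball) isBounded_closedBall
    _ ≤ 2 * R := diam_closedBall hR

end HausdorffDistance

section Nets

open Metric Module Set

variable {E : Type*} [NormedAddCommGroup E] [NormedSpace ℝ E] [FiniteDimensional ℝ E]

theorem card_le_of_isSeparated_of_subset_closedBall {S : Finset E} {δ : NNReal} {x : E} {R : ℝ}
    (hδ : 0 < δ) (hR : 0 ≤ R) (hsep : IsSeparated δ (S : Set E))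
    (hS : (S : Set E) ⊆ closedBall x R) : (S.card : ℝ) ≤ (1 + 2 * R / δ) ^ finrank ℝ E := by
  let _ : MeasurableSpace E := borel E
  have _ : BorelSpace E := ⟨rfl⟩
  let μ : Measure E := Measure.addHaar
  have hδ_half : (0 : ℝ) < δ / 2 := by positivity
  have hdisj : (S : Set E).PairwiseDisjoint fun v => ball v (δ / 2 : ℝ) := fun v hv w hw hvw => by
    have hlt : (δ : ℝ≥0∞) < edist v w := hsep hv hw hvw
    rw [edist_nndist, ENNReal.coe_lt_coe] at hlt
    exact ball_disjoint_ball (by rw [add_halves]; exact hlt.le)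
  have hsub : ⋃ v ∈ S, ball v (δ / 2 : ℝ) ⊆ closedBall x (R + δ / 2) :=
    iUnion₂_subset fun v hv => ball_subset_closedBall.trans <|
      closedBall_subset_closedBall' (by rw [add_comm]; gcongr; exact hS hv)
  have hpos : 0 < μ.real (ball 0 1) :=
    ENNReal.toReal_pos (measure_ball_pos μ 0 one_pos).ne' measure_ball_lt_top.ne
  have hvol : S.card * (δ / 2 : ℝ) ^ finrank ℝ E * μ.real (ball 0 1) ≤
      (R + δ / 2) ^ finrank ℝ E * μ.real (ball 0 1) :=
    calc _ = ∑ v ∈ S, μ.real (ball v (δ / 2 : ℝ)) := by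
          simp only [measureReal_def, μ.addHaar_ball_of_pos _ hδ_half, ENNReal.toReal_mul,
            ENNReal.toReal_ofReal (pow_nonneg hδ_half.le _), Finset.sum_const, nsmul_eq_mul,
            mul_assoc]
      _ = μ.real (⋃ v ∈ S, ball v (δ / 2 : ℝ)) :=
          (measureReal_biUnion_finset hdisj fun v _ => measurableSet_ball).symm
      _ ≤ μ.real (closedBall x (R + δ / 2)) := measureReal_mono hsub measure_closedBall_lt_top.ne
      _ = _ := μ.addHaar_real_closedBall x (by positivity)
  calc (S.card : ℝ) ≤ (R + δ / 2) ^ finrank ℝ E / (δ / 2) ^ finrank ℝ E :=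
        (le_div_iff₀ (by positivity)).2 (le_of_mul_le_mul_right hvol hpos)
    _ = (1 + 2 * R / δ) ^ finrank ℝ E := by
        rw [← div_pow]
        congr 1
        field_simp
        ring

theorem exists_finset_isCover_card_le {A : Set E} {x : E} {R : ℝ} (hR : 0 ≤ R)
    (hA : A ⊆ closedBall x R) {δ : NNReal} (hδ : 0 < δ) :
    ∃ S : Finset E, (S : Set E) ⊆ A ∧ IsCover δ A (S : Set E) ∧
      (S.card : ℝ) ≤ (1 + 2 * R / δ) ^ finrank ℝ E := by
  have hpack : packingNumber δ A ≠ ⊤ := by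
    obtain ⟨N, -, hN, hcover⟩ := exists_finite_isCover_of_totallyBounded (half_pos hδ).ne'
      ((isCompact_closedBall x R).totallyBounded.subset hA)
    refine ne_top_of_le_ne_top hN.encard_lt_top.ne ?_
    calc packingNumber δ A = packingNumber (2 * (δ / 2)) A := by rw [mul_div_cancel₀ _ two_ne_zero]
      _ ≤ externalCoveringNumber (δ / 2) A := packingNumber_two_mul_le_externalCoveringNumber _ _
      _ ≤ N.encard := hcover.externalCoveringNumber_le_encard
  have hfin : (maximalSeparatedSet δ A).Finite :=
    encard_lt_top_iff.1 (encard_maximalSeparatedSet hpack ▸ hpack.lt_top)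
  obtain ⟨S, hS⟩ := hfin.exists_finset_coe
  have hSA : (S : Set E) ⊆ A := hS ▸ maximalSeparatedSet_subset
  exact ⟨S, hSA, hS ▸ isCover_maximalSeparatedSet hpack,
    card_le_of_isSeparated_of_subset_closedBall hδ hR (hS ▸ isSeparated_maximalSeparatedSet)
      (hSA.trans hA)⟩

end Nets

section Probability

variable {Ω ι : Type*} [MeasurableSpace Ω]

theorem measure_pi_setOf_exists_forall_notMem_le {κ : Type*} [Fintype ι] (μ : Measure Ω)
    [SigmaFinite μ] (S : Finset κ) (A : κ → Set Ω) {p : ℝ≥0∞} (hp : ∀ v ∈ S, μ (A v)ᶜ ≤ p) :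
    Measure.pi (fun _ : ι => μ) {X | ∃ v ∈ S, ∀ i, X i ∉ A v} ≤ S.card * p ^ Fintype.card ι := by
  have hset : {X : ι → Ω | ∃ v ∈ S, ∀ i, X i ∉ A v} =
      ⋃ v ∈ S, Set.univ.pi fun _ : ι => (A v)ᶜ := by
    ext X
    simp
  calc Measure.pi (fun _ : ι => μ) {X | ∃ v ∈ S, ∀ i, X i ∉ A v}
      ≤ ∑ v ∈ S, Measure.pi (fun _ : ι => μ) (Set.univ.pi fun _ => (A v)ᶜ) :=
        hset ▸ measure_biUnion_finset_le S _
    _ = ∑ v ∈ S, μ (A v)ᶜ ^ Fintype.card ι := by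
        simp only [Measure.pi_pi, Finset.prod_const, Finset.card_univ]
    _ ≤ ∑ _v ∈ S, p ^ Fintype.card ι := Finset.sum_le_sum fun v hv => by gcongr; exact hp v hv
    _ = S.card * p ^ Fintype.card ι := by rw [Finset.sum_const, nsmul_eq_mul]

theorem measure_compl_le_ofReal_exp_neg {μ : Measure Ω} [IsProbabilityMeasure μ] {A : Set Ω}
    (hA : MeasurableSet A) {p : ℝ} (hp : ENNReal.ofReal p ≤ μ A) :
    μ Aᶜ ≤ ENNReal.ofReal (Real.exp (-p)) := by
  have hreal : p ≤ μ.real A := (ENNReal.ofReal_le_iff_le_toReal (measure_ne_top μ A)).1 hp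
  rw [← ofReal_measureReal, probReal_compl_eq_one_sub hA]
  exact ENNReal.ofReal_le_ofReal (by linarith [Real.add_one_le_exp (-p)])

theorem lintegral_rpow_le_rpow_add_rpow_mul_measure {P : Measure Ω} [IsProbabilityMeasure P]
    {f : Ω → ℝ} {D t q : ℝ} (hf : ∀ ω, 0 ≤ f ω) (hfD : ∀ᵐ ω ∂P, f ω ≤ D) (hq : 0 ≤ q) :
    ∫⁻ ω, ENNReal.ofReal (f ω ^ q) ∂P ≤
      ENNReal.ofReal (t ^ q) + ENNReal.ofReal (D ^ q) * P {ω | t < f ω} := by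
  have hpt : ∀ᵐ ω ∂P, ENNReal.ofReal (f ω ^ q) ≤ ENNReal.ofReal (t ^ q) +
      {ω | t < f ω}.indicator (fun _ => ENNReal.ofReal (D ^ q)) ω := by
    filter_upwards [hfD] with ω hω
    have hnonneg := hf ω
    by_cases h : t < f ω
    · rw [Set.indicator_of_mem (show ω ∈ {ω | t < f ω} from h)]
      exact le_add_left (by gcongr)
    · exact le_add_right (by gcongr; exact not_lt.1 h)
  calc ∫⁻ ω, ENNReal.ofReal (f ω ^ q) ∂P
      ≤ ∫⁻ ω, (ENNReal.ofReal (t ^ q) +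
          {ω | t < f ω}.indicator (fun _ => ENNReal.ofReal (D ^ q)) ω) ∂P := lintegral_mono_ae hpt
    _ = ENNReal.ofReal (t ^ q) +
          ∫⁻ ω, {ω | t < f ω}.indicator (fun _ => ENNReal.ofReal (D ^ q)) ω ∂P := by
        rw [lintegral_add_left measurable_const, lintegral_const, measure_univ, mul_one]
    _ ≤ _ := by gcongr; exact lintegral_indicator_const_le _ _

theorem ae_pi_forall [Fintype ι] {μ : Measure Ω} [SigmaFinite μ] {p : Ω → Prop}
    (h : ∀ᵐ x ∂μ, p x) : ∀ᵐ X ∂Measure.pi fun _ : ι => μ, ∀ i, p (X i) :=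
  ae_all_iff.2 fun _ => Measure.tendsto_eval_ae_ae.eventually h

end Probability

section RandomPoints

open Metric Module Set

theorem lintegral_hausdorffDist_convexHull_rpow_le_add {E ι : Type*} [NormedAddCommGroup E]
    [NormedSpace ℝ E] [MeasurableSpace E] [Fintype ι] [Nonempty ι] {K : Set E} {μ : Measure E}
    [IsProbabilityMeasure μ] {t q : ℝ} (hball : K ⊆ closedBall 0 1) (hμK : ∀ᵐ x ∂μ, x ∈ K)
    (hq : 0 ≤ q) :
    ∫⁻ X : ι → E, ENNReal.ofReal (hausdorffDist (convexHull ℝ (range X)) K ^ q)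
        ∂(Measure.pi fun _ => μ) ≤
      ENNReal.ofReal (t ^ q) + ENNReal.ofReal (2 ^ q) * Measure.pi (fun _ : ι => μ)
        {X | t < hausdorffDist (convexHull ℝ (range X)) K} := by
  refine lintegral_rpow_le_rpow_add_rpow_mul_measure (fun _ => hausdorffDist_nonneg) ?_ hq
  filter_upwards [ae_pi_forall hμK] with X hX
  have hrange : range X ⊆ K := range_subset_iff.2 hX
  simpa using hausdorffDist_convexHull_le_two_mul zero_le_one (range_nonempty X)
    (hrange.trans hball) ((range_nonempty X).mono hrange) hball

/-- Every cap of `K` of height `t ≤ r` has `μ`-mass at least `c * t ^ α`. This is all that the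
moment bound uses about the law `μ` of the random points, besides its being carried by `K`. -/
def CapMassBound {E : Type*} [NormedAddCommGroup E] [InnerProductSpace ℝ E] [MeasurableSpace E]
    (μ : Measure E) (K : Set E) (c α r : ℝ) : Prop :=
  ∀ u : E, ‖u‖ = 1 → ∀ t : ℝ, 0 < t → t ≤ r → ENNReal.ofReal (c * t ^ α) ≤ μ (capHalfSpace K u t)

variable {E ι : Type*} [NormedAddCommGroup E] [InnerProductSpace ℝ E] [FiniteDimensional ℝ E]
  [MeasurableSpace E] [BorelSpace E] [Fintype ι] [Nonempty ι]
  {K : Set E} {μ : Measure E} [IsProbabilityMeasure μ] {c α r t q : ℝ}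

theorem measure_pi_lt_hausdorffDist_convexHull_le (hK : Convex ℝ K) (hcomp : IsCompact K)
    (hball : K ⊆ closedBall 0 1) (hμK : ∀ᵐ x ∂μ, x ∈ K) (hcap : CapMassBound μ K c α r)
    (ht : 0 < t) (htr : t ≤ r) :
    Measure.pi (fun _ : ι => μ) {X | 2 * t < hausdorffDist (convexHull ℝ (range X)) K} ≤
      ENNReal.ofReal ((1 + 4 / t) ^ finrank ℝ E *
        Real.exp (-(Fintype.card ι * (c * t ^ α)))) := by
  obtain ⟨S, hS, hcover, hcard⟩ := exists_finset_isCover_card_le (A := sphere (0 : E) 1)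
    zero_le_one sphere_subset_closedBall (Real.toNNReal_pos.2 (half_pos ht))
  have hmiss : ∀ v ∈ S, μ (capHalfSpace K v t)ᶜ ≤ ENNReal.ofReal (Real.exp (-(c * t ^ α))) :=
    fun v hv => measure_compl_le_ofReal_exp_neg (isOpen_capHalfSpace hcomp).measurableSet
      (hcap v (mem_sphere_zero_iff_norm.1 (hS hv)) t ht htr)
  calc Measure.pi (fun _ : ι => μ) {X | 2 * t < hausdorffDist (convexHull ℝ (range X)) K}
      ≤ Measure.pi (fun _ : ι => μ) {X | ∃ v ∈ S, ∀ i, X i ∉ capHalfSpace K v t} :=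
        measure_mono_ae <| (ae_pi_forall hμK).mono fun X hX hlt =>
          exists_forall_notMem_capHalfSpace_of_lt_hausdorffDist hK hball ht.le hcover hX hlt
    _ ≤ S.card * ENNReal.ofReal (Real.exp (-(c * t ^ α))) ^ Fintype.card ι :=
        measure_pi_setOf_exists_forall_notMem_le μ S _ hmiss
    _ = ENNReal.ofReal (S.card * Real.exp (-(Fintype.card ι * (c * t ^ α)))) := by
        rw [← ENNReal.ofReal_pow (Real.exp_nonneg _), ← Real.exp_nat_mul, mul_neg,
          ENNReal.ofReal_mul (Nat.cast_nonneg _), ENNReal.ofReal_natCast]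
    _ ≤ _ := by
        refine ENNReal.ofReal_le_ofReal (mul_le_mul_of_nonneg_right (hcard.trans_eq ?_)
          (Real.exp_nonneg _))
        rw [Real.coe_toNNReal _ (half_pos ht).le]
        ring

theorem measure_pi_lt_hausdorffDist_convexHull_le_rpow (hK : Convex ℝ K) (hcomp : IsCompact K)
    (hball : K ⊆ closedBall 0 1) (hμK : ∀ᵐ x ∂μ, x ∈ K) (hcap : CapMassBound μ K c α r)
    (hr : 0 < r) (hq : 0 ≤ q) (ht : 0 < t)
    (hexp : Real.exp (-(Fintype.card ι * (c * t ^ α))) ≤ t ^ (finrank ℝ E + q)) :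
    Measure.pi (fun _ : ι => μ) {X | 2 * t < hausdorffDist (convexHull ℝ (range X)) K} ≤
      ENNReal.ofReal (((r + 4) ^ finrank ℝ E + r ^ (-q)) * t ^ q) := by
  rcases le_or_gt t r with htr | hrt
  · refine (measure_pi_lt_hausdorffDist_convexHull_le hK hcomp hball hμK hcap ht htr).trans
      (ENNReal.ofReal_le_ofReal ?_)
    calc (1 + 4 / t) ^ finrank ℝ E * Real.exp (-(Fintype.card ι * (c * t ^ α)))
        ≤ (1 + 4 / t) ^ finrank ℝ E * t ^ (finrank ℝ E + q) := by gcongr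
      _ = (t + 4) ^ finrank ℝ E * t ^ q := by
        rw [Real.rpow_add ht, Real.rpow_natCast, ← mul_assoc, ← mul_pow, add_mul, one_mul,
          div_mul_cancel₀ _ ht.ne']
      _ ≤ ((r + 4) ^ finrank ℝ E + r ^ (-q)) * t ^ q := by
        gcongr
        exact (pow_le_pow_left₀ (by positivity) (by gcongr) _).trans
          (le_add_of_nonneg_right (by positivity))
  · refine prob_le_one.trans (ENNReal.one_le_ofReal.2 ?_)
    calc 1 = r ^ (-q) * r ^ q := by rw [← Real.rpow_add hr, neg_add_cancel, Real.rpow_zero]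
      _ ≤ ((r + 4) ^ finrank ℝ E + r ^ (-q)) * t ^ q := by
        gcongr
        exact le_add_of_nonneg_left (by positivity)

theorem lintegral_hausdorffDist_convexHull_rpow_le (hK : Convex ℝ K) (hcomp : IsCompact K)
    (hball : K ⊆ closedBall 0 1) (hμK : ∀ᵐ x ∂μ, x ∈ K) (hcap : CapMassBound μ K c α r)
    (hr : 0 < r) (hq : 0 ≤ q) (ht : 0 < t)
    (hexp : Real.exp (-(Fintype.card ι * (c * t ^ α))) ≤ t ^ (finrank ℝ E + q)) :
    ∫⁻ X : ι → E, ENNReal.ofReal (hausdorffDist (convexHull ℝ (range X)) K ^ q)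
        ∂(Measure.pi fun _ => μ) ≤
      ENNReal.ofReal (2 ^ q * (1 + (r + 4) ^ finrank ℝ E + r ^ (-q)) * t ^ q) :=
  calc _ ≤ ENNReal.ofReal ((2 * t) ^ q) + ENNReal.ofReal (2 ^ q) *
        Measure.pi (fun _ : ι => μ) {X | 2 * t < hausdorffDist (convexHull ℝ (range X)) K} :=
        lintegral_hausdorffDist_convexHull_rpow_le_add hball hμK hq
    _ ≤ ENNReal.ofReal ((2 * t) ^ q) + ENNReal.ofReal (2 ^ q) *
        ENNReal.ofReal (((r + 4) ^ finrank ℝ E + r ^ (-q)) * t ^ q) := by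
        gcongr
        exact measure_pi_lt_hausdorffDist_convexHull_le_rpow hK hcomp hball hμK hcap hr hq ht hexp
    _ = ENNReal.ofReal (2 ^ q * (1 + (r + 4) ^ finrank ℝ E + r ^ (-q)) * t ^ q) := by
        rw [← ENNReal.ofReal_mul (by positivity), ← ENNReal.ofReal_add (by positivity)
          (by positivity), Real.mul_rpow two_pos.le ht.le]
        ring_nf

theorem exp_neg_mul_rpow_le_rpow {n : ℕ} (hn : 2 ≤ n) {α c B p t : ℝ} (hα : 0 < α) (hB : 2 ≤ B)
    (hp : 0 ≤ p) (hpB : p ≤ α * c * B) (ht : 0 < t) (htα : t ^ α = B * (Real.log n / n)) :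
    Real.exp (-(n * (c * t ^ α))) ≤ t ^ p := by
  have hlog : 1 / 2 ≤ Real.log n := by
    have hmono : Real.log 2 ≤ Real.log n := Real.log_le_log two_pos (by exact_mod_cast hn)
    linarith [Real.log_two_gt_d9]
  have hinv_le : (n : ℝ)⁻¹ ≤ t ^ α := by
    rw [htα, mul_div_assoc', inv_eq_one_div]
    gcongr
    nlinarith
  have hlog_t : -Real.log n ≤ α * Real.log t := by
    rw [← Real.log_inv, ← Real.log_rpow ht]
    exact Real.log_le_log (by positivity) hinv_le
  rw [Real.rpow_def_of_pos ht p, Real.exp_le_exp]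
  refine le_of_mul_le_mul_left ?_ hα
  calc α * -(n * (c * t ^ α)) = α * c * B * -Real.log n := by
        rw [htα]
        field_simp
    _ ≤ p * -Real.log n := mul_le_mul_of_nonpos_right hpB (by linarith)
    _ ≤ p * (α * Real.log t) := mul_le_mul_of_nonneg_left hlog_t hp
    _ = α * (Real.log t * p) := by ring

theorem exists_forall_lintegral_hausdorffDist_convexHull_rpow_le (hα : 0 < α) (hc : 0 < c)
    (hr : 0 < r) (hq : 0 ≤ q) :
    ∃ C : ℝ, 0 < C ∧ ∀ n : ℕ, 2 ≤ n → ∀ (K : Set E) (μ : Measure E) [IsProbabilityMeasure μ],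
      Convex ℝ K → IsCompact K → K ⊆ closedBall 0 1 → (∀ᵐ x ∂μ, x ∈ K) → CapMassBound μ K c α r →
      ∫⁻ X : Fin n → E, ENNReal.ofReal (hausdorffDist (convexHull ℝ (range X)) K ^ q)
          ∂(Measure.pi fun _ => μ) ≤ ENNReal.ofReal (C * (Real.log n / n) ^ (q / α)) := by
  set p : ℝ := finrank ℝ E + q
  set B : ℝ := 2 + p / (α * c)
  have hp : 0 ≤ p := by positivity
  have hB : 2 ≤ B := le_add_of_nonneg_right (by positivity)
  have hpB : p ≤ α * c * B := by
    rw [mul_add, mul_div_cancel₀ _ (by positivity)]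
    exact le_add_of_nonneg_left (by positivity)
  refine ⟨2 ^ q * (1 + (r + 4) ^ finrank ℝ E + r ^ (-q)) * B ^ (q / α), by positivity,
    fun n hn K μ _ hK hcomp hball hμK hcap => ?_⟩
  have : NeZero n := ⟨by lia⟩
  have hrate : 0 < Real.log n / n :=
    div_pos (Real.log_pos (by exact_mod_cast hn)) (by positivity)
  set t : ℝ := (B * (Real.log n / n)) ^ α⁻¹
  have ht : 0 < t := by positivity
  have htα : t ^ α = B * (Real.log n / n) := Real.rpow_inv_rpow (by positivity) hα.ne'
  have hexp := exp_neg_mul_rpow_le_rpow hn hα hB hp hpB ht htα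
  refine (lintegral_hausdorffDist_convexHull_rpow_le hK hcomp hball hμK hcap hr hq ht
    (by rwa [Fintype.card_fin])).trans_eq ?_
  rw [mul_assoc _ (B ^ (q / α)), ← Real.mul_rpow (by positivity) hrate.le, ← htα,
    ← Real.rpow_mul ht.le, mul_div_cancel₀ _ hα.ne']

end RandomPoints

section RollingBodies

open Metric Module Set

variable {m : ℕ} {r t : ℝ} {K : ConvexBody (EuclideanSpace ℝ (Fin (m + 1)))}
  {u : EuclideanSpace ℝ (Fin (m + 1))}

theorem interior_nonempty_of_mem_rollingBodies (hK : K ∈ rollingBodies r (m + 1)) :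
    (interior (K : Set (EuclideanSpace ℝ (Fin (m + 1))))).Nonempty := by
  rw [nonempty_iff_ne_empty]
  intro hint
  have hsub : (K : Set (EuclideanSpace ℝ (Fin (m + 1)))) ⊆ frontier K := by
    rw [K.isClosed.frontier_eq, hint, sdiff_empty]
  exact hK.1.ne' (measure_mono_null hsub (K.convex.addHaar_frontier volume))

theorem ofReal_rpow_mul_le_hausdorffMeasure_frontier_inter_capHalfSpace (hr : 0 < r)
    (hK : K ∈ rollingBodies r (m + 1)) (hu : ‖u‖ = 1) (ht : 0 < t) (htr : t ≤ r) :
    ENNReal.ofReal ((r / 2 * t) ^ (m / 2 : ℝ)) * μH[m] (ball (0 : EuclideanSpace ℝ (Fin m)) 1) ≤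
      μH[m] (frontier K ∩ capHalfSpace K u t) := by
  have : Fact (finrank ℝ (EuclideanSpace ℝ (Fin (m + 1))) = m + 1) := ⟨by simp⟩
  obtain ⟨x, hx, hmax⟩ := K.isCompact.exists_isMaxOn K.nonempty (f := inner ℝ u) (by fun_prop)
  obtain ⟨c, hxc, hball⟩ :=
    hK.2.2 x (mem_frontier_of_isMaxOn_inner (norm_ne_zero_iff.1 (hu ▸ one_ne_zero)) hx hmax)
  have hsqrt : (r / 2 * t) ^ (m / 2 : ℝ) = √(r / 2 * t) ^ m := by
    rw [Real.sqrt_eq_rpow, ← Real.rpow_mul_natCast (by positivity), one_div_mul_eq_div]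
  rw [hsqrt]
  refine le_hausdorffMeasure_frontier_inter_capHalfSpace K.isBounded hr hball hx hxc hu hmax
    (Real.sqrt_nonneg _) (Real.sqrt_le_iff.2 ⟨hr.le, by nlinarith⟩) ?_
  rw [Real.sq_sqrt (by positivity)]
  nlinarith

theorem hausdorffMeasure_frontier_pos_of_mem_rollingBodies (hr : 0 < r)
    (hK : K ∈ rollingBodies r (m + 1)) :
    0 < μH[m] (frontier (K : Set (EuclideanSpace ℝ (Fin (m + 1))))) := by
  obtain ⟨u, hu⟩ := exists_norm_eq (EuclideanSpace ℝ (Fin (m + 1))) zero_le_one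
  have hcap := ofReal_rpow_mul_le_hausdorffMeasure_frontier_inter_capHalfSpace hr hK hu hr le_rfl
  have hpos : 0 < ENNReal.ofReal ((r / 2 * r) ^ (m / 2 : ℝ)) *
      μH[m] (ball (0 : EuclideanSpace ℝ (Fin m)) 1) :=
    ENNReal.mul_pos (ENNReal.ofReal_pos.2 (by positivity)).ne' (measure_ball_pos _ _ one_pos).ne'
  exact hpos.trans_le (hcap.trans (measure_mono inter_subset_left))

theorem hausdorffMeasure_frontier_lt_top_of_mem_rollingBodies (hK : K ∈ rollingBodies r (m + 1)) :
    μH[m] (frontier (K : Set (EuclideanSpace ℝ (Fin (m + 1))))) < ∞ :=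
  hausdorffMeasure_frontier_lt_top K.convex K.isClosed (interior_nonempty_of_mem_rollingBodies hK)
    K.isBounded

theorem uniformBoundary_eq_cond (K : Set (EuclideanSpace ℝ (Fin (m + 1)))) :
    uniformBoundary K = ProbabilityTheory.cond μH[m] (frontier K) := by
  rw [uniformBoundary, Nat.cast_add_one, add_sub_cancel_right]

theorem isProbabilityMeasure_uniformBoundary (hr : 0 < r) (hK : K ∈ rollingBodies r (m + 1)) :
    IsProbabilityMeasure (uniformBoundary (K : Set (EuclideanSpace ℝ (Fin (m + 1))))) := by
  rw [uniformBoundary_eq_cond]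
  exact cond_isProbabilityMeasure_of_finite
    (hausdorffMeasure_frontier_pos_of_mem_rollingBodies hr hK).ne'
    (hausdorffMeasure_frontier_lt_top_of_mem_rollingBodies hK).ne

theorem ae_mem_uniformBoundary {d : ℕ} {K : Set (EuclideanSpace ℝ (Fin d))} (hK : IsClosed K) :
    ∀ᵐ x ∂uniformBoundary K, x ∈ K := by
  filter_upwards [ae_cond_mem isClosed_frontier.measurableSet] with x hx
  exact hK.frontier_subset hx

theorem exists_capMassBound_uniformBoundary (m : ℕ) (hr : 0 < r) :
    ∃ c : ℝ, 0 < c ∧ ∀ K ∈ rollingBodies r (m + 1),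
      CapMassBound (uniformBoundary (K : Set (EuclideanSpace ℝ (Fin (m + 1))))) K c (m / 2) r := by
  set A : ℝ≥0∞ := μH[m] (frontier (closedBall (0 : EuclideanSpace ℝ (Fin (m + 1))) 1))
  set κ : ℝ≥0∞ := μH[m] (ball (0 : EuclideanSpace ℝ (Fin m)) 1)
  have hA : A ≠ ∞ := (hausdorffMeasure_frontier_lt_top (convex_closedBall _ _) isClosed_closedBall
    ((nonempty_ball.2 one_pos).mono ball_subset_interior_closedBall) isBounded_closedBall).ne
  have hpos : 0 < A⁻¹ * κ :=
    ENNReal.mul_pos (ENNReal.inv_ne_zero.2 hA) (measure_ball_pos _ _ one_pos).ne'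
  obtain ⟨a, ha_pos, ha⟩ := ENNReal.lt_iff_exists_nnreal_btwn.1 hpos
  rw [ENNReal.coe_pos] at ha_pos
  refine ⟨a * (r / 2) ^ (m / 2 : ℝ), by positivity, fun K hK u hu t ht htr => ?_⟩
  have hfrontier : μH[m] (frontier (K : Set (EuclideanSpace ℝ (Fin (m + 1))))) ≤ A :=
    hausdorffMeasure_frontier_mono K.convex K.isClosed (interior_nonempty_of_mem_rollingBodies hK)
      hK.2.1 isBounded_closedBall m.cast_nonneg
  calc ENNReal.ofReal (a * (r / 2) ^ (m / 2 : ℝ) * t ^ (m / 2 : ℝ))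
      = a * ENNReal.ofReal ((r / 2 * t) ^ (m / 2 : ℝ)) := by
        rw [mul_assoc, ← Real.mul_rpow (by positivity) ht.le, ENNReal.ofReal_mul a.coe_nonneg,
          ENNReal.ofReal_coe_nnreal]
    _ ≤ A⁻¹ * κ * ENNReal.ofReal ((r / 2 * t) ^ (m / 2 : ℝ)) := by gcongr
    _ = A⁻¹ * (ENNReal.ofReal ((r / 2 * t) ^ (m / 2 : ℝ)) * κ) := by ring
    _ ≤ (μH[m] (frontier (K : Set (EuclideanSpace ℝ (Fin (m + 1))))))⁻¹ *
          μH[m] (frontier K ∩ capHalfSpace K u t) :=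
        mul_le_mul' (ENNReal.inv_le_inv.2 hfrontier)
          (ofReal_rpow_mul_le_hausdorffMeasure_frontier_inter_capHalfSpace hr hK hu ht htr)
    _ = uniformBoundary (K : Set (EuclideanSpace ℝ (Fin (m + 1)))) (capHalfSpace K u t) := by
        rw [uniformBoundary_eq_cond, cond_apply isClosed_frontier.measurableSet]

end RollingBodies

theorem mainTheorem11_general (d : ℕ) (hd : 2 ≤ d) (r : ℝ) (hr : 0 < r) (q : ℝ) (hq : 0 ≤ q) :
    (∀ K ∈ rollingBodies r d,
      IsProbabilityMeasure (uniformBoundary (K : Set (EuclideanSpace ℝ (Fin d))))) ∧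
    ∃ C : ℝ, 0 < C ∧ ∀ n : ℕ, 2 ≤ n →
      (⨆ K ∈ rollingBodies r d, boundaryMoment (K : Set (EuclideanSpace ℝ (Fin d))) n q) ≤
        ENNReal.ofReal (C * (Real.log n / n) ^ (2 * q / ((d : ℝ) - 1))) := by
  obtain ⟨m, rfl⟩ := Nat.exists_eq_add_of_le' (one_le_two.trans hd)
  have hm : (0 : ℝ) < m / 2 := div_pos (Nat.cast_pos.2 (by lia)) two_pos
  have hexponent : 2 * q / (((m + 1 : ℕ) : ℝ) - 1) = q / (m / 2 : ℝ) := by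
    rw [Nat.cast_add_one, add_sub_cancel_right, div_div_eq_mul_div, mul_comm]
  refine ⟨fun K hK => isProbabilityMeasure_uniformBoundary hr hK, ?_⟩
  obtain ⟨c, hc, hcap⟩ := exists_capMassBound_uniformBoundary m hr
  obtain ⟨C, hC, hmoment⟩ := exists_forall_lintegral_hausdorffDist_convexHull_rpow_le
    (E := EuclideanSpace ℝ (Fin (m + 1))) hm hc hr hq
  refine ⟨C, hC, fun n hn => iSup₂_le fun K hK => ?_⟩
  have := isProbabilityMeasure_uniformBoundary hr hK
  rw [hexponent]
  exact hmoment n hn K _ K.convex K.isCompact hK.2.1 (ae_mem_uniformBoundary K.isClosed) (hcap K hK)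

theorem mainTheorem11 (d : ℕ) (hd : 2 ≤ d) (r : ℝ) (hr0 : 0 < r) (hr1 : r ≤ 1)
    (q : ℝ) (hq : 1 ≤ q) :
    (∀ K ∈ rollingBodies r d,
      IsProbabilityMeasure (uniformBoundary (K : Set (EuclideanSpace ℝ (Fin d))))) ∧
    ∃ C : ℝ, 0 < C ∧ ∀ n : ℕ, 2 ≤ n →
      (⨆ K ∈ rollingBodies r d, boundaryMoment (K : Set (EuclideanSpace ℝ (Fin d))) n q) ≤
        ENNReal.ofReal (C * (Real.log n / n) ^ (2 * q / ((d : ℝ) - 1))) :=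
  mainTheorem11_general d hd r hr0 q (zero_le_one.trans hq)
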